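/- Let $\Omega\subset\mathbb R^3$ be a compact convex set with smooth ($C^\infty$) boundary that contains the origin in its interior. For a unit vector $\omega\in S^2$ let $H(\omega)=\max_{x\in\Omega}\langle x,\omega\rangle$ be the distance from the origin to the support plane of $\Omega$ with outer normal $\omega$, and let $B(\omega)=H(\omega)+H(-\omega)$ be the width of $\Omega$ in the direction $\omega$. Let $C(\omega)$ be the boundary curve of the orthogonal projection of $\Omega$ onto the plane $\omega^\perp$ through the origin (the boundary being taken in that plane), and let the circumference $U(\omega)$ of $\Omega$ in the direction $\omega$ be the arc length of $C(\omega)$. Then $\Omega$ has constant width if and only if it has constant circumference: there is a real number $c$ with $B(\omega)=c$ for all $\omega\in S^2$ if and only if there is a (finite) real number $c'\ge 0$ with $U(\omega)=c'$ for all $\omega\in S^2$. -/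

import Mathlib

open scoped ENNReal NNReal RealInnerProductSpace

noncomputable section

/-- Three-dimensional Euclidean space. -/
abbrev E3 : Type := EuclideanSpace ℝ (Fin 3)

/-- The boundary of `Ω` is a smooth surface: near each of its points it is the zero set of a
`C^∞` function whose differential does not vanish at that point. -/
def HasSmoothBoundary (Ω : Set E3) : Prop :=
  ∀ p ∈ frontier Ω, ∃ V : Set E3, IsOpen V ∧ p ∈ V ∧ ∃ f : E3 → ℝ,
    ContDiff ℝ ((⊤ : ℕ∞) : WithTop ℕ∞) f ∧ fderiv ℝ f p ≠ 0 ∧ frontier Ω ∩ V = {x | f x = 0} ∩ V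

/-- The support function `H(ω)` of `Ω`. For a unit vector `ω` and a compact convex `Ω` with the
origin in its interior, the plane `⟪x, ω⟫ = H(ω)` is the support plane of `Ω` with outer
normal `ω`, and `H(ω)` is its distance from the origin. -/
def supportFn (Ω : Set E3) (ω : E3) : ℝ :=
  sSup ((fun x : E3 => ⟪x, ω⟫) '' Ω)

/-- The width `B(ω) = H(ω) + H(-ω)` of `Ω` in the direction `ω`. -/
def bodyWidth (Ω : Set E3) (ω : E3) : ℝ :=
  supportFn Ω ω + supportFn Ω (-ω)

/-- `γ`, restricted to `[0, 1]`, is a parametrization of `C` as a simple closed curve. -/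
structure IsSimpleClosedParam {X : Type*} [TopologicalSpace X] (γ : ℝ → X) (C : Set X) :
    Prop where
  continuousOn : ContinuousOn γ (Set.Icc 0 1)
  closed : γ 0 = γ 1
  injOn : Set.InjOn γ (Set.Ico 0 1)
  image_eq : γ '' Set.Icc 0 1 = C

/-- The arc length of a simple closed curve `C`: the length (supremum of the lengths of inscribed
polygons, that is, total variation) of a parametrization of `C` as a simple closed curve.
The length does not depend on the parametrization, so the infimum is over equal numbers; it is `∞`
if `C` is not rectifiable or not a simple closed curve. -/
def arcLength {X : Type*} [PseudoEMetricSpace X] (C : Set X) : ℝ≥0∞ :=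
  ⨅ (γ : ℝ → X) (_ : IsSimpleClosedParam γ C), eVariationOn γ (Set.Icc 0 1)

/-- The orthogonal projection of `Ω` onto the plane through the origin perpendicular to `ω`, as a
subset of that plane. -/
def shadow (Ω : Set E3) (ω : E3) : Set (Submodule.span ℝ {ω})ᗮ :=
  (Submodule.span ℝ {ω})ᗮ.orthogonalProjectionOnto '' Ω

/-- The boundary curve `C(ω)` of the projection of `Ω` (boundary relative to the plane). -/
def boundaryCurve (Ω : Set E3) (ω : E3) : Set (Submodule.span ℝ {ω})ᗮ :=
  frontier (shadow Ω ω)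

/-- The circumference `U(ω)` of `Ω` in the direction `ω`. -/
def circumference (Ω : Set E3) (ω : E3) : ℝ≥0∞ :=
  arcLength (boundaryCurve Ω ω)

/-- `Ω` has the same width in every direction. -/
def HasConstantWidth (Ω : Set E3) : Prop :=
  ∃ c : ℝ, ∀ ω ∈ Metric.sphere (0 : E3) 1, bodyWidth Ω ω = c

/-- `Ω` has the same (finite) circumference in every direction. -/
def HasConstantCircumference (Ω : Set E3) : Prop :=
  ∃ c : ℝ≥0, ∀ ω ∈ Metric.sphere (0 : E3) 1, circumference Ω ω = (c : ℝ≥0∞)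

end

open Real intervalIntegral MeasureTheory

/-! Cauchy's formula gives the perimeter of a plane convex body as half the integral of its width
over all directions. The shadow on `ω`ᗮ has the widths of `Ω` in the directions of that plane, so
the circumference at `ω` is half the integral of `B` over the great circle orthogonal to `ω`
(`circumference_eq`). Constant width `c` thus gives circumference `π * c`. Conversely, if the
circumference is `c`, then `B - c / π` is even and continuous with zero integral over every great
circle, and it vanishes because the Funk transform is injective on even functions
(`eq_zero_of_integral_great_circle_eq_zero`).

Funk injectivity is reduced, by averaging around an axis, to an Abel equation. Cauchy's formula
comes from integrating over directions the variation of a coordinate along the curve, which is twice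
the width. -/

/-! ### An Abel integral equation. -/

theorem integral_sin_pow_mul_integral_sin_pow_succ (n : ℕ) :
    (∫ t in (0 : ℝ)..π, sin t ^ n) * ∫ t in (0 : ℝ)..π, sin t ^ (n + 1) = 2 * π / (n + 1) := by
  induction n with
  | zero => simp; ring
  | succ n ih =>
    have h := integral_sin_pow (a := 0) (b := π) n
    simp only [sin_zero, sin_pi, ne_eq, Nat.succ_ne_zero, not_false_eq_true, zero_pow, zero_mul,
      sub_self, zero_div, zero_add] at h
    rw [show n + 1 + 1 = n + 2 by rfl, h]
    have h1 : (n : ℝ) + 1 ≠ 0 := by positivity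
    have h2 : (n : ℝ) + 2 ≠ 0 := by positivity
    have h3 : ((n + 1 : ℕ) : ℝ) + 1 ≠ 0 := by positivity
    rw [mul_left_comm, mul_comm (∫ t in (0 : ℝ)..π, sin t ^ (n + 1)), ih]
    push_cast at h3 ⊢
    field_simp
    ring

theorem integral_integral_polynomial_sin_mul_sin (P : Polynomial ℝ) :
    ∫ u in (0 : ℝ)..π, ∫ t in (0 : ℝ)..π, P.eval (sin u * sin t) * sin u
      = 2 * π * ∫ z in (0 : ℝ)..1, P.eval z := by
  induction P using Polynomial.induction_on' with
  | add p q hp hq =>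
    simp only [Polynomial.eval_add, add_mul]
    have hc : ∀ p : Polynomial ℝ,
        Continuous (fun x : ℝ × ℝ => p.eval (sin x.1 * sin x.2) * sin x.1) := fun p => by
      have := p.continuous
      fun_prop
    have h1 : ∀ p : Polynomial ℝ, ∀ u : ℝ,
        IntervalIntegrable (fun t => p.eval (sin u * sin t) * sin u) volume 0 π := fun p u =>
      ((hc p).comp (Continuous.prodMk_right u)).intervalIntegrable _ _
    have h2 : ∀ p : Polynomial ℝ, IntervalIntegrable
        (fun u => ∫ t in (0 : ℝ)..π, p.eval (sin u * sin t) * sin u) volume 0 π := fun p =>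
      (continuous_parametric_intervalIntegral_of_continuous' (hc p) 0 π).intervalIntegrable _ _
    simp_rw [fun u => integral_add (h1 p u) (h1 q u)]
    rw [integral_add (h2 p) (h2 q), hp, hq, integral_add (p.continuous.intervalIntegrable _ _)
      (q.continuous.intervalIntegrable _ _), mul_add]
  | monomial n a =>
    have h : ∀ u t : ℝ, (Polynomial.monomial n a).eval (sin u * sin t) * sin u
        = (a * sin u ^ (n + 1)) * sin t ^ n := fun u t => by
      rw [Polynomial.eval_monomial]; ring
    simp_rw [h, intervalIntegral.integral_const_mul, Polynomial.eval_monomial]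
    rw [intervalIntegral.integral_mul_const, intervalIntegral.integral_const_mul, intervalIntegral.integral_const_mul, integral_pow, mul_assoc,
      mul_comm (∫ t in (0 : ℝ)..π, sin t ^ (n + 1)), integral_sin_pow_mul_integral_sin_pow_succ]
    simp
    ring

/-- Archimedes' hat-box theorem: `sin u * sin t` is a coordinate on the unit sphere, `sin u du dt`
is area, and on the hemisphere of area `2 * π` this coordinate is uniform on `[0, 1]`. The proof
extends the polynomial case by Weierstrass approximation. -/
theorem integral_integral_comp_sin_mul_sin {F : ℝ → ℝ} (hF : Continuous F) :
    ∫ u in (0 : ℝ)..π, ∫ t in (0 : ℝ)..π, F (sin u * sin t) * sin u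
      = 2 * π * ∫ z in (0 : ℝ)..1, F z := by
  have hc : ∀ G : ℝ → ℝ, Continuous G →
      Continuous (fun x : ℝ × ℝ => G (sin x.1 * sin x.2) * sin x.1) := fun G hG => by fun_prop
  have h1 : ∀ G : ℝ → ℝ, Continuous G → ∀ u : ℝ,
      IntervalIntegrable (fun t => G (sin u * sin t) * sin u) volume 0 π := fun G hG u =>
    ((hc G hG).comp (Continuous.prodMk_right u)).intervalIntegrable _ _
  have h2 : ∀ G : ℝ → ℝ, Continuous G → IntervalIntegrable
      (fun u => ∫ t in (0 : ℝ)..π, G (sin u * sin t) * sin u) volume 0 π := fun G hG =>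
    (continuous_parametric_intervalIntegral_of_continuous' (hc G hG) 0 π).intervalIntegrable _ _
  rw [← sub_eq_zero]
  refine abs_nonpos_iff.mp (le_of_forall_pos_le_add fun ε hε => ?_)
  -- An error `δ` in `F` costs at most `δ * π * π` on the left and `2 * π * δ` on the right.
  obtain ⟨P, hP⟩ := exists_polynomial_near_of_continuousOn 0 1 F hF.continuousOn
    (ε / (π * π + 2 * π)) (by positivity)
  set δ := ε / (π * π + 2 * π) with hδ
  have hδε : δ * π * π + 2 * π * δ = ε := by
    rw [hδ]; field_simp
  have hA : |(∫ u in (0 : ℝ)..π, ∫ t in (0 : ℝ)..π, P.eval (sin u * sin t) * sin u)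
      - ∫ u in (0 : ℝ)..π, ∫ t in (0 : ℝ)..π, F (sin u * sin t) * sin u| ≤ δ * π * π := by
    rw [← integral_sub (h2 _ P.continuous) (h2 _ hF)]
    have := norm_integral_le_of_norm_le_const (a := 0) (b := π) (C := δ * π)
      (f := fun u => (∫ t in (0 : ℝ)..π, P.eval (sin u * sin t) * sin u)
      - ∫ t in (0 : ℝ)..π, F (sin u * sin t) * sin u) ?_
    · simpa [abs_of_pos pi_pos] using this
    intro u hu
    rw [Set.uIoc_of_le pi_pos.le] at hu
    rw [← integral_sub (h1 _ P.continuous u) (h1 _ hF u)]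
    have := norm_integral_le_of_norm_le_const (a := 0) (b := π) (C := δ)
      (f := fun t => P.eval (sin u * sin t) * sin u - F (sin u * sin t) * sin u) ?_
    · simpa [abs_of_pos pi_pos] using this
    intro t ht
    rw [Set.uIoc_of_le pi_pos.le] at ht
    have su := sin_nonneg_of_mem_Icc ⟨hu.1.le, hu.2⟩
    have st := sin_nonneg_of_mem_Icc ⟨ht.1.le, ht.2⟩
    rw [← sub_mul, norm_eq_abs, abs_mul, abs_of_nonneg su]
    have := (hP (sin u * sin t) ⟨mul_nonneg su st, mul_le_one₀ (sin_le_one u) st (sin_le_one t)⟩).le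
    calc _ ≤ δ * 1 := mul_le_mul this (sin_le_one u) su ((abs_nonneg _).trans this)
      _ = δ := mul_one δ
  have hB : |(∫ z in (0 : ℝ)..1, P.eval z) - ∫ z in (0 : ℝ)..1, F z| ≤ δ := by
    rw [← integral_sub (P.continuous.intervalIntegrable _ _) (hF.intervalIntegrable _ _)]
    have := norm_integral_le_of_norm_le_const (a := 0) (b := 1) (C := δ)
      (f := fun z => P.eval z - F z) ?_
    · simpa using this
    intro z hz
    rw [Set.uIoc_of_le zero_le_one] at hz
    exact (hP z ⟨hz.1.le, hz.2⟩).le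
  rw [integral_integral_polynomial_sin_mul_sin] at hA
  have hB' : |2 * π * ((∫ z in (0 : ℝ)..1, P.eval z) - ∫ z in (0 : ℝ)..1, F z)| ≤ 2 * π * δ := by
    rw [abs_mul, abs_of_pos two_pi_pos]
    gcongr
  rw [abs_le] at hA hB' ⊢
  constructor <;> linarith [hA.1, hA.2, hB'.1, hB'.2]

/-- Abel inversion: putting `s = r * sin u` and integrating against `sin u` turns the hypothesis
into the vanishing of the primitive of `F` on `[0, 1]`. Differentiation handles the open interval,
continuity the endpoint. -/
theorem apply_one_eq_zero_of_integral_mul_sin_eq_zero {F : ℝ → ℝ} (hF : Continuous F)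
    (h : ∀ s ∈ Set.Icc (0 : ℝ) 1, ∫ t in (0 : ℝ)..π, F (s * sin t) = 0) : F 1 = 0 := by
  have h0 : ∀ r ∈ Set.Icc (0 : ℝ) 1, ∫ z in (0 : ℝ)..r, F z = 0 := by
    intro r hr
    have := integral_integral_comp_sin_mul_sin (F := fun z => F (r * z)) (by fun_prop)
    have hz : ∫ u in (0 : ℝ)..π, ∫ t in (0 : ℝ)..π, F (r * (sin u * sin t)) * sin u = 0 := by
      rw [integral_congr (g := fun _ => (0 : ℝ)), intervalIntegral.integral_zero]
      intro u hu
      rw [Set.uIcc_of_le pi_pos.le] at hu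
      have su := sin_nonneg_of_mem_Icc hu
      simp only [intervalIntegral.integral_mul_const, ← mul_assoc]
      rw [h _ ⟨mul_nonneg hr.1 su, mul_le_one₀ hr.2 su (sin_le_one u)⟩, zero_mul]
    rw [hz] at this
    have h1 := mul_integral_comp_mul_left (a := 0) (b := 1) (f := F) r
    rw [mul_zero, mul_one] at h1
    rw [← h1]
    rcases mul_eq_zero.mp this.symm with h2 | h2
    · exact absurd h2 two_pi_pos.ne'
    · rw [h2, mul_zero]
  have h1 : ∀ r ∈ Set.Ioo (0 : ℝ) 1, F r = 0 := by
    intro r hr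
    rw [← Continuous.deriv_integral F hF 0 r]
    have : (fun u => ∫ x in (0 : ℝ)..u, F x) =ᶠ[nhds r] fun _ => 0 := by
      filter_upwards [Ioo_mem_nhds hr.1 hr.2] with x hx using h0 x ⟨hx.1.le, hx.2.le⟩
    rw [this.deriv_eq, deriv_const]
  have : Set.Icc (0 : ℝ) 1 ⊆ F ⁻¹' {0} := by
    rw [← closure_Ioo zero_ne_one]
    exact closure_minimal h1 (isClosed_singleton.preimage hF)
  exact this ⟨zero_le_one, le_rfl⟩

/-! ### The Funk transform. -/

/-- The two integrands differ by the phase shift `arg (c + d i)`, which is invisible over a full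
period. -/
theorem integral_comp_rotate {E : Type*} [NormedAddCommGroup E] [InnerProductSpace ℝ E]
    (f : E → ℝ) (q a b : E) (c d : ℝ) :
    ∫ φ in (0 : ℝ)..2 * π, f (q + ((c * cos φ - d * sin φ) • a + (c * sin φ + d * cos φ) • b))
      = ∫ φ in (0 : ℝ)..2 * π, f (q + √(c ^ 2 + d ^ 2) • (cos φ • a + sin φ • b)) := by
  set g : ℝ → ℝ := fun φ => f (q + √(c ^ 2 + d ^ 2) • (cos φ • a + sin φ • b)) with hg
  have hper : Function.Periodic g (2 * π) := fun φ => by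
    simp only [hg, cos_add_two_pi, sin_add_two_pi]
  set w : ℂ := ⟨c, d⟩
  have hw : ‖w‖ = √(c ^ 2 + d ^ 2) := by
    rw [Complex.norm_eq_sqrt_sq_add_sq]
  have hcw : √(c ^ 2 + d ^ 2) * cos w.arg = c := by
    rw [← hw, Complex.norm_mul_cos_arg]
  have hdw : √(c ^ 2 + d ^ 2) * sin w.arg = d := by
    rw [← hw, Complex.norm_mul_sin_arg]
  have := hper.intervalIntegral_add_eq w.arg 0
  rw [zero_add] at this
  rw [← this, ← zero_add w.arg, add_right_comm, ← integral_comp_add_right, zero_add]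
  refine integral_congr fun φ _ => ?_
  simp only [hg, cos_add, sin_add, smul_add, smul_smul]
  congr 4
  · linear_combination sin φ * hdw - cos φ * hcw
  · linear_combination -sin φ * hcw - cos φ * hdw

/-- Injectivity of the Funk transform on even functions. -/
theorem eq_zero_of_integral_great_circle_eq_zero {E : Type*} [NormedAddCommGroup E]
    [InnerProductSpace ℝ E] {f : E → ℝ} (hf : Continuous f) (heven : ∀ x, f (-x) = f x)
    {p a b : E} (hp : ‖p‖ = 1) (ha : ‖a‖ = 1) (hb : ‖b‖ = 1) (hpa : inner ℝ p a = 0)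
    (hpb : inner ℝ p b = 0) (hab : inner ℝ a b = 0)
    (h : ∀ v w : E, ‖v‖ = 1 → ‖w‖ = 1 → inner ℝ v w = 0 →
      ∫ t in (0 : ℝ)..2 * π, f (cos t • v + sin t • w) = 0) : f p = 0 := by
  have hhalf : ∀ v w : E, ‖v‖ = 1 → ‖w‖ = 1 → inner ℝ v w = 0 →
      ∫ t in (0 : ℝ)..π, f (cos t • v + sin t • w) = 0 := by
    intro v w hv hw hvw
    have hc : Continuous fun t : ℝ => f (cos t • v + sin t • w) := by fun_prop
    have h1 := integral_add_adjacent_intervals (hc.intervalIntegrable (μ := volume) 0 π)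
      (hc.intervalIntegrable π (2 * π))
    have h2 := integral_comp_add_right (a := 0) (b := π)
      (fun t => f (cos t • v + sin t • w)) π
    rw [zero_add, ← two_mul] at h2
    have h3 : ∀ t : ℝ, f (cos (t + π) • v + sin (t + π) • w) = f (cos t • v + sin t • w) :=
      fun t => by rw [← heven, cos_add_pi, sin_add_pi]; congr 1; module
    simp only [h3] at h2
    rw [← h2, h v w hv hw hvw] at h1
    linarith
  -- Integral of `f` over the parallel at height `z` about the axis `p`; at `z = 1` the parallel
  -- shrinks to `p`. For `|z| > 1` the root is `0`, which keeps `F` continuous on all of `ℝ`.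
  set F : ℝ → ℝ := fun z => ∫ φ in (0 : ℝ)..2 * π,
    f (z • p + √(1 - z ^ 2) • (cos φ • a + sin φ • b)) with hFdef
  have hF : Continuous F := by
    apply continuous_parametric_intervalIntegral_of_continuous'
    unfold Function.uncurry
    fun_prop
  have hF1 : F 1 = 2 * π * f p := by
    simp [hFdef]
  have hFz : F 1 = 0 := by
    refine apply_one_eq_zero_of_integral_mul_sin_eq_zero hF fun s hs => ?_
    have hs1 : 0 ≤ 1 - s ^ 2 := by nlinarith [hs.1, hs.2]
    set c := √(1 - s ^ 2) with hcdef
    have hc2 : c ^ 2 = 1 - s ^ 2 := sq_sqrt hs1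
    -- For fixed `φ`, `t` runs along a great circle with maximal height `s`; for fixed `t`, `φ` runs
    -- around the parallel at height `s * sin t`. Swapping the integrals links `F` to the half
    -- circles in `hhalf`.
    let G : ℝ → ℝ → ℝ := fun t φ => f (cos t • (-sin φ • a + cos φ • b) +
      sin t • (s • p + c • (cos φ • a + sin φ • b)))
    have hG : Continuous (Function.uncurry G) := by
      unfold Function.uncurry
      fun_prop
    have h1 : ∀ t : ℝ, F (s * sin t) = ∫ φ in (0 : ℝ)..2 * π, G t φ := by
      intro t
      have := integral_comp_rotate f ((s * sin t) • p) a b (c * sin t) (cos t)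
      rw [show (c * sin t) ^ 2 + cos t ^ 2 = 1 - (s * sin t) ^ 2 by
        rw [mul_pow, hc2, cos_sq' t]; ring] at this
      simp only [hFdef]
      rw [← this]
      refine integral_congr fun φ _ => ?_
      simp only [G]
      congr 1
      module
    simp only [h1]
    rw [intervalIntegral_intervalIntegral_swap]
    · rw [integral_congr (g := fun _ => (0 : ℝ)), intervalIntegral.integral_zero]
      intro φ _
      have hba : inner ℝ b a = 0 := by rw [real_inner_comm, hab]
      have haa : inner ℝ a a = (1 : ℝ) := by rw [real_inner_self_eq_norm_sq, ha, one_pow]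
      have hbb : inner ℝ b b = (1 : ℝ) := by rw [real_inner_self_eq_norm_sq, hb, one_pow]
      have hpp : inner ℝ p p = (1 : ℝ) := by rw [real_inner_self_eq_norm_sq, hp, one_pow]
      have hap : inner ℝ a p = 0 := by rw [real_inner_comm, hpa]
      have hbp : inner ℝ b p = 0 := by rw [real_inner_comm, hpb]
      refine hhalf _ _ ?_ ?_ ?_
      · rw [← sq_eq_sq₀ (norm_nonneg _) zero_le_one, ← real_inner_self_eq_norm_sq]
        simp only [inner_add_left, inner_add_right, real_inner_smul_left, real_inner_smul_right,
          haa, hbb, hab, hba]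
        linear_combination sin_sq_add_cos_sq φ
      · rw [← sq_eq_sq₀ (norm_nonneg _) zero_le_one, ← real_inner_self_eq_norm_sq]
        simp only [inner_add_left, inner_add_right, real_inner_smul_left, real_inner_smul_right,
          haa, hbb, hpp, hab, hba, hpa, hap, hpb, hbp]
        linear_combination c ^ 2 * sin_sq_add_cos_sq φ + hc2
      · simp only [inner_add_left, inner_add_right, real_inner_smul_left, real_inner_smul_right,
          haa, hbb, hab, hba, hap, hbp]
        ring
    · exact (hG.continuousOn.integrableOn_compact (isCompact_uIcc.prod isCompact_uIcc)).mono_set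
        (Set.prod_mono Set.uIoc_subset_uIcc Set.uIoc_subset_uIcc)
  rw [hF1] at hFz
  exact (mul_eq_zero.mp hFz).resolve_left two_pi_pos.ne'

/-! ### Variation of real functions and sequences. -/

section Variation

theorem exists_mem_Ioo_eq_of_mem_uIoo {g : ℝ → ℝ} {a b c : ℝ} (hab : a ≤ b)
    (hg : ContinuousOn g (Set.Icc a b)) (hc : c ∈ Set.uIoo (g a) (g b)) :
    ∃ x ∈ Set.Ioo a b, g x = c := by
  rcases le_total (g a) (g b) with h | h
  · rw [Set.uIoo_of_le h] at hc
    exact intermediate_value_Ioo hab hg hc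
  · rw [Set.uIoo_of_ge h] at hc
    exact intermediate_value_Ioo' hab hg hc

/-- A continuous function with values in `[m, M]` that takes every value of `(m, M)` at most twice
has variation at most `2 (M - m)`. -/
theorem sum_abs_sub_le_of_forall_level {g : ℝ → ℝ} (hg : ContinuousOn g (Set.Icc 0 1)) {m M : ℝ}
    (hmem : ∀ t ∈ Set.Icc (0 : ℝ) 1, g t ∈ Set.Icc m M)
    (hlevel : ∀ c ∈ Set.Ioo m M, ∀ x ∈ Set.Ioo (0 : ℝ) 1, ∀ y ∈ Set.Ioo (0 : ℝ) 1,
      ∀ z ∈ Set.Ioo (0 : ℝ) 1, g x = c → g y = c → g z = c → x ≠ y → x ≠ z → y ≠ z → False)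
    {t : ℕ → ℝ} (ht : Monotone t) (ht01 : ∀ i, t i ∈ Set.Icc (0 : ℝ) 1) (n : ℕ) :
    ∑ i ∈ Finset.range n, |g (t (i + 1)) - g (t i)| ≤ 2 * (M - m) := by
  classical
  have hmM : 0 ≤ M - m := by
    have := hmem 0 ⟨le_rfl, zero_le_one⟩
    linarith [this.1, this.2]
  -- Banach indicatrix: the sum is the integral over `c` of the number of `A i` containing `c`. Each
  -- such `i` yields a solution of `g x = c` in its own open subinterval, so there are at most two.
  let A : ℕ → Set ℝ := fun i => Set.uIoo (g (t i)) (g (t (i + 1)))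
  have hA : ∀ i, MeasurableSet (A i) := fun i => measurableSet_Ioo
  have hAsub : ∀ i, A i ⊆ Set.Ioo m M := fun i c hc =>
    ⟨(le_min (hmem _ (ht01 i)).1 (hmem _ (ht01 (i + 1))).1).trans_lt hc.1,
      hc.2.trans_le (max_le (hmem _ (ht01 i)).2 (hmem _ (ht01 (i + 1))).2)⟩
  have hpt : ∀ c, ∑ i ∈ Finset.range n, (A i).indicator (1 : ℝ → ENNReal) c
      ≤ (Set.Ioo m M).indicator (fun _ => 2) c := by
    intro c
    have hsum : ∑ i ∈ Finset.range n, (A i).indicator (1 : ℝ → ENNReal) c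
        = ((Finset.range n).filter fun i => c ∈ A i).card := by
      simp [Set.indicator_apply]
    rw [hsum]
    by_cases hc : c ∈ Set.Ioo m M
    · rw [Set.indicator_of_mem hc]
      have : ((Finset.range n).filter fun i => c ∈ A i).card ≤ 2 := by
        by_contra! hlt
        obtain ⟨i, hi, j, hj, k, hk, hij, hik, hjk⟩ := Finset.two_lt_card.mp hlt
        have hex : ∀ i ∈ (Finset.range n).filter fun i => c ∈ A i,
            ∃ x ∈ Set.Ioo (t i) (t (i + 1)), g x = c := fun i hi =>
          exists_mem_Ioo_eq_of_mem_uIoo (ht (Nat.le_succ i))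
            (hg.mono (Set.Icc_subset_Icc (ht01 i).1 (ht01 (i + 1)).2)) (Finset.mem_filter.mp hi).2
        have hne : ∀ {i j : ℕ} {x y : ℝ}, x ∈ Set.Ioo (t i) (t (i + 1)) →
            y ∈ Set.Ioo (t j) (t (j + 1)) → i ≠ j → x ≠ y := by
          rintro i j x y hx hy hij rfl
          rcases lt_or_gt_of_ne hij with h | h
          · exact absurd (hx.2.trans_le (ht h)) hy.1.not_gt
          · exact absurd (hy.2.trans_le (ht h)) hx.1.not_gt
        have h01 : ∀ {i : ℕ} {x : ℝ}, x ∈ Set.Ioo (t i) (t (i + 1)) → x ∈ Set.Ioo (0 : ℝ) 1 :=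
          fun {i x} hx => ⟨(ht01 i).1.trans_lt hx.1, hx.2.trans_le (ht01 (i + 1)).2⟩
        obtain ⟨x, hx, hgx⟩ := hex i hi
        obtain ⟨y, hy, hgy⟩ := hex j hj
        obtain ⟨z, hz, hgz⟩ := hex k hk
        exact hlevel c hc x (h01 hx) y (h01 hy) z (h01 hz) hgx hgy hgz (hne hx hy hij)
          (hne hx hz hik) (hne hy hz hjk)
      exact_mod_cast this
    · rw [Set.indicator_of_notMem hc, Finset.filter_false_of_mem]
      · simp
      · exact fun i _ hi => hc (hAsub i hi)
  have key : ENNReal.ofReal (∑ i ∈ Finset.range n, |g (t (i + 1)) - g (t i)|)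
      ≤ ENNReal.ofReal (2 * (M - m)) := by
    calc ENNReal.ofReal (∑ i ∈ Finset.range n, |g (t (i + 1)) - g (t i)|)
        = ∑ i ∈ Finset.range n, volume (A i) := by
          rw [ENNReal.ofReal_sum_of_nonneg fun _ _ => abs_nonneg _]
          simp only [A, volume_uIoo]
      _ = ∫⁻ c, ∑ i ∈ Finset.range n, (A i).indicator (1 : ℝ → ENNReal) c := by
          rw [lintegral_finsetSum _ fun i _ => measurable_one.indicator (hA i)]
          exact Finset.sum_congr rfl fun i _ => (lintegral_indicator_one (hA i)).symm
      _ ≤ ∫⁻ c, (Set.Ioo m M).indicator (fun _ => 2) c := lintegral_mono hpt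
      _ = ENNReal.ofReal (2 * (M - m)) := by
          rw [lintegral_indicator_const measurableSet_Ioo, volume_Ioo,
            ENNReal.ofReal_mul zero_le_two, ENNReal.ofReal_ofNat]
  exact (ENNReal.ofReal_le_ofReal_iff (by positivity)).mp key

/-- A closed sequence travels between its values at `j` and `k` twice: directly, and through the
index `n`, identified with `0`. -/
theorem two_mul_sub_le_sum_abs_sub {g : ℕ → ℝ} {n j k : ℕ} (hclosed : g n = g 0) (hj : j ≤ n)
    (hk : k ≤ n) : 2 * (g k - g j) ≤ ∑ i ∈ Finset.range n, |g (i + 1) - g i| := by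
  have key : ∀ {j k : ℕ}, j ≤ k → k ≤ n →
      2 * |g k - g j| ≤ ∑ i ∈ Finset.range n, |g (i + 1) - g i| := by
    intro j k hjk hk
    have h : ∀ {a b : ℕ}, a ≤ b → |g b - g a| ≤ ∑ i ∈ Finset.Ico a b, |g (i + 1) - g i| := by
      intro a b hab
      have := dist_le_Ico_sum_dist g hab
      simpa only [dist_comm, Real.dist_eq, abs_sub_comm] using this
    have h1 := h (Nat.zero_le j)
    have h2 := h hjk
    have h3 := h hk
    rw [Finset.range_eq_Ico, ← Finset.sum_Ico_consecutive _ (Nat.zero_le j) (hjk.trans hk),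
      ← Finset.sum_Ico_consecutive _ hjk hk]
    have h4 : |g k - g j| ≤ |g j - g 0| + |g n - g k| := by
      rw [hclosed, abs_sub_comm (g j), abs_sub_comm (g 0) (g k), add_comm]
      exact abs_sub_le (g k) (g 0) (g j)
    linarith
  rcases le_total j k with h | h
  · exact (mul_le_mul_of_nonneg_left (le_abs_self _) zero_le_two).trans (key h hk)
  · refine (mul_le_mul_of_nonneg_left (le_abs_self _) zero_le_two).trans ?_
    rw [abs_sub_comm]
    exact key h hj

end Variation

/-! ### Directions in the plane. -/

section Plane

variable {V : Type*} [NormedAddCommGroup V] [InnerProductSpace ℝ V]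

/-- The unit vector that makes the angle `θ` with the first vector of an orthonormal basis. -/
noncomputable def angleDir (b : OrthonormalBasis (Fin 2) ℝ V) (θ : ℝ) : V := cos θ • b 0 + sin θ • b 1

variable (b : OrthonormalBasis (Fin 2) ℝ V)

theorem continuous_angleDir : Continuous (angleDir b) := by
  unfold angleDir
  fun_prop

theorem inner_angleDir (x : V) (θ : ℝ) :
    inner ℝ x (angleDir b θ) = cos θ * inner ℝ x (b 0) + sin θ * inner ℝ x (b 1) := by
  simp only [angleDir, inner_add_right, real_inner_smul_right]

theorem inner_angleDir_angleDir (θ φ : ℝ) :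
    inner ℝ (angleDir b θ) (angleDir b φ) = cos (θ - φ) := by
  have h01 : inner ℝ (b 0) (b 1) = (0 : ℝ) := b.inner_eq_zero (by decide)
  have h10 : inner ℝ (b 1) (b 0) = (0 : ℝ) := b.inner_eq_zero (by decide)
  have h00 : inner ℝ (b 0) (b 0) = (1 : ℝ) := b.inner_eq_one 0
  have h11 : inner ℝ (b 1) (b 1) = (1 : ℝ) := b.inner_eq_one 1
  rw [inner_angleDir]
  simp only [angleDir, inner_add_left, real_inner_smul_left, h01, h10, h00, h11, cos_sub]
  ring

theorem norm_angleDir (θ : ℝ) : ‖angleDir b θ‖ = 1 := by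
  rw [← sq_eq_sq₀ (norm_nonneg _) zero_le_one, ← real_inner_self_eq_norm_sq,
    inner_angleDir_angleDir, sub_self, cos_zero, one_pow]

theorem angleDir_add_pi (θ : ℝ) : angleDir b (θ + π) = -angleDir b θ := by
  simp only [angleDir, cos_add_pi, sin_add_pi]
  module

theorem exists_eq_norm_smul_angleDir (x : V) : ∃ θ, x = ‖x‖ • angleDir b θ := by
  set w : ℂ := ⟨inner ℝ (b 0) x, inner ℝ (b 1) x⟩ with hw
  have h : x = ‖w‖ • angleDir b w.arg := by
    rw [angleDir, smul_add, smul_smul, smul_smul, Complex.norm_mul_cos_arg,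
      Complex.norm_mul_sin_arg]
    have := b.sum_repr' x
    rw [Fin.sum_univ_two] at this
    exact this.symm
  have hn : ‖x‖ = ‖w‖ := by
    conv_lhs => rw [h]
    rw [norm_smul, norm_angleDir, mul_one, norm_norm]
  exact ⟨w.arg, by rw [hn]; exact h⟩

theorem integral_abs_cos : ∫ θ in (0 : ℝ)..2 * π, |cos θ| = 4 := by
  have hper : Function.Periodic (fun θ => |cos θ|) (2 * π) := fun θ => by
    simp only [cos_add_two_pi]
  have h := hper.intervalIntegral_add_eq (-(π / 2)) 0
  rw [zero_add] at h
  have hc : Continuous fun θ : ℝ => |cos θ| := by fun_prop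
  have hp := pi_pos
  rw [← h, ← integral_add_adjacent_intervals (b := π / 2) (hc.intervalIntegrable _ _)
    (hc.intervalIntegrable _ _)]
  have h1 : ∫ θ in (-(π / 2))..(π / 2), |cos θ| = ∫ θ in (-(π / 2))..(π / 2), cos θ := by
    refine integral_congr fun θ hθ => ?_
    rw [Set.uIcc_of_le (by linarith)] at hθ
    exact abs_of_nonneg (cos_nonneg_of_mem_Icc hθ)
  have h2 : ∫ θ in (π / 2)..(-(π / 2) + 2 * π), |cos θ|
      = ∫ θ in (π / 2)..(-(π / 2) + 2 * π), -cos θ := by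
    refine integral_congr fun θ hθ => ?_
    rw [Set.uIcc_of_le (by linarith)] at hθ
    exact abs_of_nonpos (cos_nonpos_of_pi_div_two_le_of_le hθ.1 (by linarith [hθ.2]))
  rw [h1, h2, intervalIntegral.integral_neg, integral_cos, integral_cos, sin_add_two_pi, sin_neg,
    sin_pi_div_two]
  norm_num

/-- This recovers lengths from one-dimensional projections, the integral-geometric core of Cauchy's
formula. -/
theorem integral_abs_inner_angleDir (x : V) :
    ∫ θ in (0 : ℝ)..2 * π, |inner ℝ x (angleDir b θ)| = 4 * ‖x‖ := by
  obtain ⟨φ, hφ⟩ := exists_eq_norm_smul_angleDir b x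
  have h : ∀ θ, |inner ℝ x (angleDir b θ)| = ‖x‖ * |cos (θ - φ)| := fun θ => by
    conv_lhs => rw [hφ]
    rw [real_inner_smul_left, inner_angleDir_angleDir, abs_mul, abs_norm, ← cos_neg, neg_sub]
  have hper : Function.Periodic (fun θ => |cos θ|) (2 * π) := fun θ => by
    simp only [cos_add_two_pi]
  have h2 := hper.intervalIntegral_add_eq (-φ) 0
  rw [zero_add, integral_abs_cos] at h2
  simp only [h]
  rw [intervalIntegral.integral_const_mul, integral_comp_sub_right (fun θ => |cos θ|), zero_sub,
    show 2 * π - φ = -φ + 2 * π by ring, h2, mul_comm]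

end Plane

/-! ### Cauchy's formula for a parametrized boundary curve. -/

section PlaneConvex

variable {V : Type*} [NormedAddCommGroup V] [InnerProductSpace ℝ V]

theorem mem_frontier_of_isMaxOn_inner {K : Set V} {x v : V} (hx : x ∈ K) (hv : v ≠ 0)
    (hmax : ∀ y ∈ K, inner ℝ y v ≤ inner ℝ x v) : x ∈ frontier K := by
  refine ⟨subset_closure hx, fun hint => ?_⟩
  have hlim : Filter.Tendsto (fun ε : ℝ => x + ε • v) (nhdsWithin 0 (Set.Ioi 0)) (nhds x) := by
    have : Continuous fun ε : ℝ => x + ε • v := by fun_prop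
    have h := this.tendsto 0
    rw [zero_smul, add_zero] at h
    exact h.mono_left nhdsWithin_le_nhds
  obtain ⟨ε, hεK, hε⟩ := ((hlim.eventually (mem_interior_iff_mem_nhds.mp hint)).and
    self_mem_nhdsWithin).exists
  have h := hmax _ hεK
  rw [inner_add_left, real_inner_smul_left] at h
  have : 0 < ε * inner ℝ v v := mul_pos hε (real_inner_self_pos.mpr hv)
  linarith

/-- If both points lay on the same side of `q`, the nearer would be in an open segment from an
interior point to a point of the closure, hence interior. -/
theorem Convex.mul_nonpos_of_mem_frontier {K : Set V} (hK : Convex ℝ K) {q w : V} {s t : ℝ}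
    (hq : q ∈ interior K) (hs : q + s • w ∈ frontier K) (ht : q + t • w ∈ frontier K)
    (hne : s ≠ t) : s * t ≤ 0 := by
  have key : ∀ {s t : ℝ}, q + s • w ∈ frontier K → q + t • w ∈ frontier K → 0 < s / t →
      s / t < 1 → False := by
    intro s t hs ht h0 h1
    have ht0 : t ≠ 0 := fun h => by simp [h] at h0
    refine hs.2 (hK.openSegment_interior_closure_subset_interior hq ht.1
      ⟨1 - s / t, s / t, by linarith, h0, by ring, ?_⟩)
    rw [smul_add, smul_smul, div_mul_cancel₀ s ht0]
    module
  by_contra! hpos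
  have hst : 0 < s / t := div_pos_iff.mpr (pos_and_pos_or_neg_and_neg_of_mul_pos hpos)
  rcases lt_trichotomy (s / t) 1 with h | h | h
  · exact key hs ht hst h
  · have ht0 : t ≠ 0 := fun h => by simp [h] at hpos
    exact hne (by rwa [div_eq_one_iff_eq ht0] at h)
  · refine key ht hs ?_ ?_
    · rw [← inv_div]; exact inv_pos.mpr hst
    · rw [← inv_div]; exact inv_lt_one_of_one_lt₀ h

variable (b : OrthonormalBasis (Fin 2) ℝ V)

theorem eq_inner_smul_of_inner_angleDir_eq_zero {x : V} {θ : ℝ}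
    (h : inner ℝ x (angleDir b θ) = 0) : ∃ s : ℝ, x = s • angleDir b (θ + π / 2) := by
  obtain ⟨φ, hφ⟩ := exists_eq_norm_smul_angleDir b x
  rw [hφ, real_inner_smul_left, inner_angleDir_angleDir, mul_eq_zero] at h
  rcases h with h | h
  · exact ⟨0, by rw [norm_eq_zero.mp h, zero_smul]⟩
  · refine ⟨‖x‖ * sin (φ - θ), ?_⟩
    nth_rw 1 [hφ]
    rw [mul_smul]
    congr 1
    rw [show φ = θ + (φ - θ) by ring]
    simp only [angleDir, cos_add θ, sin_add θ, h, cos_pi_div_two, sin_pi_div_two, add_sub_cancel_left]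
    module

/-- A line meeting the interior of a convex set of the plane meets its frontier at most twice. -/
theorem Convex.frontier_inner_eq_three {K : Set V} (hK : Convex ℝ K)
    (hne : (interior K).Nonempty) {θ c : ℝ} {p r x y z : V} (hp : p ∈ K) (hr : r ∈ K)
    (hpc : inner ℝ p (angleDir b θ) < c) (hrc : c < inner ℝ r (angleDir b θ))
    (hx : x ∈ frontier K) (hy : y ∈ frontier K) (hz : z ∈ frontier K)
    (hxc : inner ℝ x (angleDir b θ) = c) (hyc : inner ℝ y (angleDir b θ) = c)
    (hzc : inner ℝ z (angleDir b θ) = c) (hxy : x ≠ y) (hxz : x ≠ z) (hyz : y ≠ z) : False := by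
  set u := angleDir b θ
  have hcont : Continuous fun v : V => inner ℝ v u := by fun_prop
  -- Interior points near `p` and `r` lie strictly on either side of the line, so the connected
  -- interior contains a point `q` of the line.
  have hcl := hK.closure_interior_eq_closure_of_nonempty_interior hne
  obtain ⟨p', hp'c, hp'⟩ := mem_closure_iff.mp (hcl.symm ▸ subset_closure hp)
    {v | inner ℝ v u < c} (isOpen_Iio.preimage hcont) hpc
  obtain ⟨r', hr'c, hr'⟩ := mem_closure_iff.mp (hcl.symm ▸ subset_closure hr)
    {v | c < inner ℝ v u} (isOpen_Ioi.preimage hcont) hrc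
  obtain ⟨q, hq, hqc⟩ := hK.interior.isPreconnected.intermediate_value hp' hr' hcont.continuousOn
    ⟨(show inner ℝ p' u < c from hp'c).le, (show c < inner ℝ r' u from hr'c).le⟩
  have hline : ∀ v : V, inner ℝ v u = c → ∃ s : ℝ, v = q + s • angleDir b (θ + π / 2) := by
    intro v hv
    obtain ⟨s, hs⟩ := eq_inner_smul_of_inner_angleDir_eq_zero b (x := v - q) (θ := θ) (by
      rw [inner_sub_left]; exact sub_eq_zero.mpr (hv.trans hqc.symm))
    exact ⟨s, by rw [← hs, add_sub_cancel]⟩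
  have hne0 : ∀ s : ℝ, q + s • angleDir b (θ + π / 2) ∈ frontier K → s ≠ 0 := by
    rintro s hs rfl
    rw [zero_smul, add_zero] at hs
    exact hs.2 hq
  obtain ⟨s₁, rfl⟩ := hline x hxc
  obtain ⟨s₂, rfl⟩ := hline y hyc
  obtain ⟨s₃, rfl⟩ := hline z hzc
  have h12 := hK.mul_nonpos_of_mem_frontier hq hx hy fun h => hxy (by rw [h])
  have h13 := hK.mul_nonpos_of_mem_frontier hq hx hz fun h => hxz (by rw [h])
  have h23 := hK.mul_nonpos_of_mem_frontier hq hy hz fun h => hyz (by rw [h])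
  have h1 := hne0 _ hx
  have h2 := hne0 _ hy
  have h3 := hne0 _ hz
  -- Among three nonzero reals two share a sign.
  rcases lt_or_gt_of_ne h1 with h1 | h1 <;> rcases lt_or_gt_of_ne h2 with h2 | h2 <;>
    rcases lt_or_gt_of_ne h3 with h3 | h3 <;> 
    first
    | linarith [mul_pos h1 h2]
    | linarith [mul_pos h1 h3]
    | linarith [mul_pos h2 h3]
    | linarith [mul_pos_of_neg_of_neg h1 h2]
    | linarith [mul_pos_of_neg_of_neg h1 h3]
    | linarith [mul_pos_of_neg_of_neg h2 h3]

variable {b} {K : Set V} {h : V → ℝ} {γ : ℝ → V}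

/-- A line through the interior meets the frontier at most twice and `γ` is injective on `[0, 1)`,
so the coordinate along `u` takes each value strictly between its extremes at most twice on `(0,
1)`. -/
theorem sum_abs_inner_le_of_isSimpleClosedParam (hK : Convex ℝ K) (hKc : IsClosed K)
    (hne : (interior K).Nonempty)
    (hh : ∀ v : V, IsGreatest ((fun x => inner ℝ x v) '' K) (h v))
    (hγ : IsSimpleClosedParam γ (frontier K)) {t : ℕ → ℝ} (ht : Monotone t)
    (ht01 : ∀ i, t i ∈ Set.Icc (0 : ℝ) 1) (n : ℕ) (θ : ℝ) :
    ∑ i ∈ Finset.range n, |inner ℝ (γ (t (i + 1)) - γ (t i)) (angleDir b θ)|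
      ≤ 2 * (h (angleDir b θ) + h (-angleDir b θ)) := by
  set u := angleDir b θ with hu
  have hmem : ∀ s ∈ Set.Icc (0 : ℝ) 1, γ s ∈ frontier K := fun s hs =>
    hγ.image_eq ▸ Set.mem_image_of_mem γ hs
  obtain ⟨r, hr, hru⟩ := (hh u).1
  obtain ⟨p, hp, hpu⟩ := (hh (-u)).1
  simp only [inner_neg_right] at hru hpu
  have hpu' : inner ℝ p u = -h (-u) := by linarith
  have := sum_abs_sub_le_of_forall_level (g := fun s => inner ℝ (γ s) u) (m := -h (-u)) (M := h u)
    (hγ.continuousOn.inner continuousOn_const) (fun s hs => ?_) ?_ ht ht01 n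
  · simpa only [inner_sub_left, sub_neg_eq_add] using this
  · have hs' := hKc.frontier_subset (hmem s hs)
    have h1 := (hh u).2 ⟨_, hs', rfl⟩
    have h2 := (hh (-u)).2 ⟨_, hs', rfl⟩
    simp only [inner_neg_right] at h1 h2
    exact ⟨by linarith, h1⟩
  · intro c hc x hx y hy z hz hxc hyc hzc hxy hxz hyz
    have hI : ∀ {s : ℝ}, s ∈ Set.Ioo (0 : ℝ) 1 → s ∈ Set.Ico (0 : ℝ) 1 := fun hs => ⟨hs.1.le, hs.2⟩
    have hC : ∀ {s : ℝ}, s ∈ Set.Ioo (0 : ℝ) 1 → γ s ∈ frontier K := fun hs =>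
      hmem _ ⟨hs.1.le, hs.2.le⟩
    exact hK.frontier_inner_eq_three b hne hp hr (hpu'.trans_lt hc.1) (hru ▸ hc.2)
      (hC hx) (hC hy) (hC hz) hxc hyc hzc (fun e => hxy (hγ.injOn (hI hx) (hI hy) e))
      (fun e => hxz (hγ.injOn (hI hx) (hI hz) e)) (fun e => hyz (hγ.injOn (hI hy) (hI hz) e))

theorem integral_sum_abs_inner_angleDir (b : OrthonormalBasis (Fin 2) ℝ V) (n : ℕ) (x : ℕ → V) :
    ∫ θ in (0 : ℝ)..2 * π, ∑ i ∈ Finset.range n, |inner ℝ (x (i + 1) - x i) (angleDir b θ)|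
      = 4 * ∑ i ∈ Finset.range n, dist (x (i + 1)) (x i) := by
  have hb := continuous_angleDir b
  rw [intervalIntegral.integral_finsetSum fun i _ => by
    apply Continuous.intervalIntegrable; fun_prop]
  simp only [integral_abs_inner_angleDir, ← Finset.mul_sum, dist_eq_norm]

theorem sum_edist_eq_ofReal {ι X : Type*} [PseudoMetricSpace X] (s : Finset ι) (x y : ι → X) :
    ∑ i ∈ s, edist (x i) (y i) = ENNReal.ofReal (∑ i ∈ s, dist (x i) (y i)) := by
  rw [ENNReal.ofReal_sum_of_nonneg fun _ _ => dist_nonneg]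
  simp only [edist_dist]

theorem exists_natCast_div_near {τ : ℝ} (hτ : τ ∈ Set.Icc (0 : ℝ) 1) {n : ℕ} (hn : 0 < n) :
    ∃ k ≤ n, |τ - k / n| ≤ 1 / n := by
  have hn' : (0 : ℝ) < n := by exact_mod_cast hn
  have h0 : 0 ≤ n * τ := mul_nonneg hn'.le hτ.1
  refine ⟨⌊n * τ⌋₊, ?_, ?_⟩
  · have : (⌊n * τ⌋₊ : ℝ) ≤ n := (Nat.floor_le h0).trans (by nlinarith [hτ.2])
    exact_mod_cast this
  · have := Nat.abs_sub_floor_le h0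
    rw [show τ - ⌊n * τ⌋₊ / n = (n * τ - ⌊n * τ⌋₊) / n by field_simp, abs_div, abs_of_pos hn']
    gcongr

/-- Cauchy's formula for the length of the boundary curve of a plane convex set. -/
theorem eVariationOn_eq_of_isSimpleClosedParam (hK : Convex ℝ K) (hKc : IsClosed K)
    (hne : (interior K).Nonempty) (hcont : Continuous h)
    (hh : ∀ v : V, IsGreatest ((fun x => inner ℝ x v) '' K) (h v))
    (hγ : IsSimpleClosedParam γ (frontier K)) (b : OrthonormalBasis (Fin 2) ℝ V) :
    eVariationOn γ (Set.Icc 0 1) = ENNReal.ofReal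
      (1 / 2 * ∫ θ in (0 : ℝ)..2 * π, (h (angleDir b θ) + h (-angleDir b θ))) := by
  have hb := continuous_angleDir b
  have hB : Continuous fun θ => h (angleDir b θ) + h (-angleDir b θ) := by fun_prop
  have hI : ∀ (n : ℕ) (x : ℕ → V), IntervalIntegrable (fun θ => ∑ i ∈ Finset.range n,
      |inner ℝ (x (i + 1) - x i) (angleDir b θ)|) volume 0 (2 * π) := fun n x => by
    apply Continuous.intervalIntegrable; fun_prop
  apply le_antisymm
  -- Integrated over `θ`, the bound in each direction says that four times the polygon length is at
  -- most twice the integral of the width.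
  · refine iSup_le fun ⟨n, t, ht, ht01⟩ => ?_
    rw [sum_edist_eq_ofReal]
    apply ENNReal.ofReal_le_ofReal
    have := integral_mono_on two_pi_pos.le (hI n (γ ∘ t))
      ((hB.const_mul 2).intervalIntegrable 0 (2 * π))
      fun θ _ => sum_abs_inner_le_of_isSimpleClosedParam hK hKc hne hh hγ ht ht01 n θ
    rw [integral_sum_abs_inner_angleDir, intervalIntegral.integral_const_mul] at this
    simp only [Function.comp] at this
    linarith
  · refine ENNReal.le_of_forall_pos_le_add fun ε hε _ => ?_
    -- A fine grid comes within `η` of both support values in every direction; after integration and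
    -- division by `4` the loss is `2 * π * η = ε`.
    set η : ℝ := ε / (2 * π) with hη
    have hηpos : 0 < η := div_pos (NNReal.coe_pos.mpr hε) two_pi_pos
    obtain ⟨δ, hδ, hunif⟩ := Metric.uniformContinuousOn_iff.mp
      (isCompact_Icc.uniformContinuousOn_of_continuous hγ.continuousOn) η hηpos
    obtain ⟨m, hm⟩ := exists_nat_one_div_lt hδ
    set n := m + 1 with hn
    have hnpos : (0 : ℝ) < n := by positivity
    have hgrid : ∀ k ≤ n, (k / n : ℝ) ∈ Set.Icc (0 : ℝ) 1 := fun k hk =>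
      ⟨by positivity, (div_le_one hnpos).mpr (by exact_mod_cast hk)⟩
    set x : ℕ → V := fun k => γ (k / n) with hx
    have hclosed : x n = x 0 := by
      simp only [hx, div_self hnpos.ne', Nat.cast_zero, zero_div, hγ.closed]
    have hnear : ∀ θ, ∃ k ≤ n, h (angleDir b θ) - η ≤ inner ℝ (x k) (angleDir b θ) := by
      intro θ
      have hu1 := norm_angleDir b θ
      set u := angleDir b θ
      obtain ⟨y, hy, hyu⟩ := (hh u).1
      have hyf : y ∈ frontier K := mem_frontier_of_isMaxOn_inner hy
        (norm_ne_zero_iff.mp (by rw [hu1]; exact one_ne_zero))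
        fun z hz => ((hh u).2 ⟨z, hz, rfl⟩).trans_eq hyu.symm
      rw [← hγ.image_eq] at hyf
      obtain ⟨τ, hτ, rfl⟩ := hyf
      obtain ⟨k, hk, hkτ⟩ := exists_natCast_div_near hτ m.succ_pos
      refine ⟨k, hk, ?_⟩
      have hd := hunif τ hτ _ (hgrid k hk) (hkτ.trans_lt (by exact_mod_cast hm))
      have := real_inner_le_norm (γ τ - x k) u
      rw [hu1, mul_one, inner_sub_left, ← dist_eq_norm] at this
      simp only at hyu
      linarith
    have hsum : ∀ θ, 2 * (h (angleDir b θ) + h (-angleDir b θ) - 2 * η)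
        ≤ ∑ i ∈ Finset.range n, |inner ℝ (x (i + 1) - x i) (angleDir b θ)| := by
      intro θ
      obtain ⟨k, hk, hku⟩ := hnear θ
      obtain ⟨j, hj, hju⟩ := hnear (θ + π)
      rw [angleDir_add_pi, inner_neg_right] at hju
      have := two_mul_sub_le_sum_abs_sub (g := fun i => inner ℝ (x i) (angleDir b θ))
        (by simp only [hclosed]) hj hk
      simp only [inner_sub_left]
      linarith
    have hint := integral_mono_on two_pi_pos.le
      (Continuous.intervalIntegrable (by fun_prop) 0 (2 * π)) (hI n x) fun θ _ => hsum θ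
    rw [integral_sum_abs_inner_angleDir, intervalIntegral.integral_const_mul,
      intervalIntegral.integral_sub (hB.intervalIntegrable _ _) (by simp),
      intervalIntegral.integral_const, smul_eq_mul, sub_zero] at hint
    have hε2 : 2 * π * η = ε := by rw [hη]; field_simp
    calc ENNReal.ofReal (1 / 2 * ∫ θ in (0 : ℝ)..2 * π, (h (angleDir b θ) + h (-angleDir b θ)))
        ≤ ENNReal.ofReal ((∑ i ∈ Finset.range n, dist (x (i + 1)) (x i)) + ε) := by
          apply ENNReal.ofReal_le_ofReal
          linarith
      _ = (∑ i ∈ Finset.range n, edist (x (i + 1)) (x i)) + ε := by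
          rw [ENNReal.ofReal_add (Finset.sum_nonneg fun _ _ => dist_nonneg) ε.coe_nonneg,
            ENNReal.ofReal_coe_nnreal, sum_edist_eq_ofReal]
      _ ≤ eVariationOn γ (Set.Icc 0 1) + ε := by
          gcongr
          exact eVariationOn.sum_le_of_monotoneOn_Iic (u := fun i : ℕ => (i / n : ℝ))
            (fun i _ j _ hij => by dsimp only; gcongr) hgrid

end PlaneConvex

/-! ### Existence of a parametrization, and the perimeter. -/

section PlaneConvex

variable {V : Type*} [NormedAddCommGroup V] [InnerProductSpace ℝ V] {K : Set V}

/-- Radial parametrization: each ray from the origin meets the frontier exactly where the gauge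
equals `1`. -/
theorem exists_isSimpleClosedParam_frontier (hK : Convex ℝ K) (hbdd : Bornology.IsBounded K)
    (h0 : K ∈ nhds 0) (b : OrthonormalBasis (Fin 2) ℝ V) :
    ∃ γ : ℝ → V, IsSimpleClosedParam γ (frontier K) := by
  have hne : ∀ θ, angleDir b θ ≠ 0 := fun θ =>
    norm_ne_zero_iff.mp (by rw [norm_angleDir]; exact one_ne_zero)
  have hpos : ∀ θ, 0 < gauge K (angleDir b θ) := fun θ =>
    (gauge_pos (absorbent_nhds_zero h0) (NormedSpace.isVonNBounded_of_isBounded ℝ hbdd)).mpr (hne θ)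
  have hcont : Continuous fun θ => (gauge K (angleDir b θ))⁻¹ • angleDir b θ :=
    (((continuous_gauge hK h0).comp (continuous_angleDir b)).inv₀ fun θ => (hpos θ).ne').smul
      (continuous_angleDir b)
  refine ⟨fun s => (gauge K (angleDir b (2 * π * s)))⁻¹ • angleDir b (2 * π * s),
    ⟨(hcont.comp (continuous_const_mul _)).continuousOn, ?_, ?_, ?_⟩⟩
  · have : angleDir b (2 * π * 1) = angleDir b (2 * π * 0) := by simp [angleDir]
    simp only [this]
  · intro s hs t ht hst
    simp only at hst
    have hr : (gauge K (angleDir b (2 * π * s)))⁻¹ = (gauge K (angleDir b (2 * π * t)))⁻¹ := by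
      have := congrArg norm hst
      simpa only [norm_smul, norm_angleDir, mul_one, norm_inv, norm_of_nonneg (hpos _).le] using this
    rw [hr] at hst
    have hd := smul_right_injective V (inv_pos.mpr (hpos (2 * π * t))).ne' hst
    have hc : cos (2 * π * s - 2 * π * t) = 1 := by
      rw [← inner_angleDir_angleDir b, hd, inner_angleDir_angleDir, sub_self, cos_zero]
    obtain ⟨k, hk⟩ := (cos_eq_one_iff _).mp hc
    have hk' : (k : ℝ) = s - t := by
      have := two_pi_pos.ne'
      apply mul_right_cancel₀ this
      linarith
    have h1 : (k : ℝ) < 1 := by linarith [hs.2, ht.1]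
    have h2 : (-1 : ℝ) < k := by linarith [hs.1, ht.2]
    have hk0 : k = 0 := by
      have h1' : k < 1 := by exact_mod_cast h1
      have h2' : -1 < k := by exact_mod_cast h2
      omega
    rw [hk0, Int.cast_zero] at hk'
    linarith
  · ext x
    rw [← gauge_eq_one_iff_mem_frontier hK h0]
    constructor
    · rintro ⟨s, -, rfl⟩
      rw [gauge_smul_of_nonneg (inv_pos.mpr (hpos _)).le, smul_eq_mul,
        inv_mul_cancel₀ (hpos _).ne']
    · intro hx
      obtain ⟨θ, hθ⟩ := exists_eq_norm_smul_angleDir b x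
      refine ⟨Int.fract (θ / (2 * π)), ⟨Int.fract_nonneg _, (Int.fract_lt_one _).le⟩, ?_⟩
      have harg : 2 * π * Int.fract (θ / (2 * π)) = θ - ⌊θ / (2 * π)⌋ * (2 * π) := by
        rw [Int.fract]
        field_simp
      have hdir : angleDir b (2 * π * Int.fract (θ / (2 * π))) = angleDir b θ := by
        rw [harg]
        simp only [angleDir, cos_sub_int_mul_two_pi, sin_sub_int_mul_two_pi]
      rw [hθ, gauge_smul_of_nonneg (norm_nonneg x), smul_eq_mul] at hx
      simp only [hdir]
      rw [← eq_inv_of_mul_eq_one_left hx]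
      exact hθ.symm

/-- Cauchy's formula for the perimeter of a plane convex body. -/
theorem arcLength_frontier_eq (hK : Convex ℝ K) (hKc : IsCompact K) (h0 : (0 : V) ∈ interior K)
    {h : V → ℝ} (hcont : Continuous h)
    (hh : ∀ v : V, IsGreatest ((fun x => inner ℝ x v) '' K) (h v))
    (b : OrthonormalBasis (Fin 2) ℝ V) :
    arcLength (frontier K) = ENNReal.ofReal
      (1 / 2 * ∫ θ in (0 : ℝ)..2 * π, (h (angleDir b θ) + h (-angleDir b θ))) := by
  have hlen := fun γ hγ => eVariationOn_eq_of_isSimpleClosedParam (γ := γ) hK hKc.isClosed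
    ⟨0, h0⟩ hcont hh hγ b
  -- All parametrizations have the same length, but one must exist, since an empty infimum is `∞`.
  obtain ⟨γ, hγ⟩ := exists_isSimpleClosedParam_frontier hK hKc.isBounded
    (mem_interior_iff_mem_nhds.mp h0) b
  exact le_antisymm ((iInf₂_le γ hγ).trans_eq (hlen γ hγ))
    (le_iInf₂ fun γ hγ => (hlen γ hγ).ge)

end PlaneConvex

/-! ### Shadows of the body. -/

section Body

variable {Ω : Set E3}

theorem continuous_supportFn (hΩ : IsCompact Ω) : Continuous (supportFn Ω) :=
  hΩ.continuous_sSup (f := fun ω x => inner ℝ x ω) (by unfold Function.HasUncurry.uncurry; fun_prop)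

/-- Projecting `x` onto the plane does not change its inner product with a vector of the plane. -/
theorem isGreatest_supportFn_shadow (hΩ : IsCompact Ω) (hne : Ω.Nonempty) (ω : E3)
    (v : (Submodule.span ℝ {ω})ᗮ) :
    IsGreatest ((fun x => inner ℝ x v) '' shadow Ω ω) (supportFn Ω v) := by
  have : (fun x => inner ℝ x v) '' shadow Ω ω = (fun x : E3 => inner ℝ x (v : E3)) '' Ω := by
    rw [shadow, Set.image_image]
    refine Set.image_congr fun x _ => ?_
    exact Submodule.inner_orthogonalProjectionOnto_eq_of_mem_right v x
  rw [this]
  exact (hΩ.image (by fun_prop)).isGreatest_sSup (hne.image _)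

theorem zero_mem_interior_shadow (h0 : (0 : E3) ∈ interior Ω) (ω : E3) :
    0 ∈ interior (shadow Ω ω) := by
  have hsurj : Function.Surjective (Submodule.span ℝ {ω})ᗮ.orthogonalProjectionOnto := fun v =>
    ⟨v, Submodule.orthogonalProjectionOnto_mem_subspace_eq_self v⟩
  have hopen := (Submodule.span ℝ {ω})ᗮ.orthogonalProjectionOnto.isOpenMap hsurj
  exact hopen.image_interior_subset Ω ⟨0, h0, map_zero _⟩

theorem circumference_eq (hconv : Convex ℝ Ω) (hΩ : IsCompact Ω) (h0 : (0 : E3) ∈ interior Ω)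
    (ω : E3) (b : OrthonormalBasis (Fin 2) ℝ (Submodule.span ℝ {ω})ᗮ) :
    circumference Ω ω = ENNReal.ofReal
      (1 / 2 * ∫ θ in (0 : ℝ)..2 * π, bodyWidth Ω (angleDir b θ : (Submodule.span ℝ {ω})ᗮ)) :=
  arcLength_frontier_eq (h := fun v => supportFn Ω v)
    (hconv.linear_image (Submodule.span ℝ {ω})ᗮ.orthogonalProjectionOnto.toLinearMap)
    (hΩ.image (Submodule.span ℝ {ω})ᗮ.orthogonalProjectionOnto.continuous)
    (zero_mem_interior_shadow h0 ω)
    ((continuous_supportFn hΩ).comp continuous_subtype_val)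
    (isGreatest_supportFn_shadow hΩ ⟨0, interior_subset h0⟩ ω) b

theorem bodyWidth_nonneg (hΩ : IsCompact Ω) (h0 : (0 : E3) ∈ Ω) (ω : E3) : 0 ≤ bodyWidth Ω ω := by
  have h : ∀ v : E3, 0 ≤ supportFn Ω v := fun v =>
    le_csSup (hΩ.image (f := fun x : E3 => inner ℝ x v) (by fun_prop)).bddAbove
      ⟨0, h0, inner_zero_left v⟩
  exact add_nonneg (h ω) (h (-ω))

theorem bodyWidth_neg (ω : E3) : bodyWidth Ω (-ω) = bodyWidth Ω ω := by
  rw [bodyWidth, bodyWidth, neg_neg, add_comm]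

theorem finrank_orthogonal_span_singleton_E3 {ω : E3} (hω : ω ≠ 0) :
    Module.finrank ℝ (Submodule.span ℝ {ω})ᗮ = 2 := by
  have : Fact (Module.finrank ℝ E3 = 2 + 1) := ⟨by simp⟩
  exact Submodule.finrank_orthogonal_span_singleton hω

theorem nonempty_orthonormalBasis_orthogonal {ω : E3} (hω : ω ≠ 0) :
    Nonempty (OrthonormalBasis (Fin 2) ℝ (Submodule.span ℝ {ω})ᗮ) :=
  ⟨(stdOrthonormalBasis ℝ _).reindex (finCongr (finrank_orthogonal_span_singleton_E3 hω))⟩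

theorem exists_norm_eq_one_inner_eq_zero (v w : E3) :
    ∃ ω : E3, ‖ω‖ = 1 ∧ inner ℝ ω v = 0 ∧ inner ℝ ω w = 0 := by
  have hlt : Module.finrank ℝ (Submodule.span ℝ {v, w}) < Module.finrank ℝ E3 := by
    have h1 : Module.finrank ℝ (Submodule.span ℝ (({v, w} : Finset E3) : Set E3)) ≤ 2 :=
      (finrank_span_finset_le_card _).trans Finset.card_le_two
    rw [Finset.coe_pair] at h1
    rw [finrank_euclideanSpace_fin]
    omega
  have hbot : (Submodule.span ℝ {v, w})ᗮ ≠ ⊥ := fun h => by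
    rw [Submodule.orthogonal_eq_bot_iff] at h
    rw [h, finrank_top] at hlt
    exact lt_irrefl _ hlt
  obtain ⟨x, hx, hx0⟩ := Submodule.exists_mem_ne_zero_of_ne_bot hbot
  rw [Submodule.mem_orthogonal'] at hx
  refine ⟨(‖x‖⁻¹ : ℝ) • x, norm_smul_inv_norm hx0, ?_, ?_⟩
  · rw [real_inner_smul_left, hx v (Submodule.subset_span (by simp)), mul_zero]
  · rw [real_inner_smul_left, hx w (Submodule.subset_span (by simp)), mul_zero]

/-- With this basis the angular integral in `circumference_eq` is literally the great-circle
integral through `v` and `w`. -/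
theorem exists_orthonormalBasis_orthogonal {ω v w : E3} (hω : ω ≠ 0) (hv : ‖v‖ = 1)
    (hw : ‖w‖ = 1) (hvw : inner ℝ v w = 0) (hωv : inner ℝ ω v = 0) (hωw : inner ℝ ω w = 0) :
    ∃ b : OrthonormalBasis (Fin 2) ℝ (Submodule.span ℝ {ω})ᗮ, (b 0 : E3) = v ∧ (b 1 : E3) = w := by
  let e : Fin 2 → (Submodule.span ℝ {ω})ᗮ :=
    ![⟨v, Submodule.mem_orthogonal_singleton_iff_inner_right.mpr hωv⟩,
      ⟨w, Submodule.mem_orthogonal_singleton_iff_inner_right.mpr hωw⟩]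
  have hwv : inner ℝ w v = 0 := by rw [real_inner_comm, hvw]
  have he : Orthonormal ℝ e := by
    constructor
    · intro i
      fin_cases i
      · exact hv
      · exact hw
    · intro i j hij
      fin_cases i <;> fin_cases j
      · exact absurd rfl hij
      · exact hvw
      · exact hwv
      · exact absurd rfl hij
  have hcard : Fintype.card (Fin 2) = Module.finrank ℝ (Submodule.span ℝ {ω})ᗮ := by
    rw [Fintype.card_fin, finrank_orthogonal_span_singleton_E3 hω]
  have hcoe := coe_basisOfOrthonormalOfCardEqFinrank he hcard
  refine ⟨(basisOfOrthonormalOfCardEqFinrank he hcard).toOrthonormalBasis (by rwa [hcoe]), ?_, ?_⟩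
  · rw [Module.Basis.coe_toOrthonormalBasis, hcoe]
    rfl
  · rw [Module.Basis.coe_toOrthonormalBasis, hcoe]
    rfl

end Body

/-! ### The equivalence. -/

theorem mainTheorem4 (Ω : Set E3) (hconv : Convex ℝ Ω) (hcomp : IsCompact Ω)
    (hzero : (0 : E3) ∈ interior Ω) (hsmooth : HasSmoothBoundary Ω) :
    HasConstantWidth Ω ↔ HasConstantCircumference Ω := by
  have hne : ∀ {ω : E3}, ‖ω‖ = 1 → ω ≠ 0 := fun h =>
    norm_ne_zero_iff.mp (by rw [h]; exact one_ne_zero)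
  constructor
  · rintro ⟨c, hc⟩
    refine ⟨(π * c).toNNReal, fun ω hω => ?_⟩
    rw [mem_sphere_zero_iff_norm] at hω
    obtain ⟨b⟩ := nonempty_orthonormalBasis_orthogonal (hne hω)
    have hw : ∀ θ, bodyWidth Ω (angleDir b θ : (Submodule.span ℝ {ω})ᗮ) = c := fun θ =>
      hc _ (mem_sphere_zero_iff_norm.mpr (norm_angleDir b θ))
    rw [circumference_eq hconv hcomp hzero ω b]
    simp only [hw, intervalIntegral.integral_const, smul_eq_mul]
    rw [show 1 / 2 * ((2 * π - 0) * c) = π * c by ring]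
    rfl
  · rintro ⟨c, hc⟩
    have hB : Continuous (bodyWidth Ω) :=
      (continuous_supportFn hcomp).add ((continuous_supportFn hcomp).comp continuous_neg)
    -- The width must be `c / π`, as half its integral over an angle `2 * π` is `c`.
    refine ⟨c / π, fun p hp => ?_⟩
    rw [mem_sphere_zero_iff_norm] at hp
    obtain ⟨e⟩ := nonempty_orthonormalBasis_orthogonal (hne hp)
    have hpe : ∀ i, inner ℝ p (e i : E3) = 0 := fun i =>
      Submodule.mem_orthogonal_singleton_iff_inner_right.mp (e i).2
    refine sub_eq_zero.mp (eq_zero_of_integral_great_circle_eq_zero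
      (f := fun x => bodyWidth Ω x - c / π) (hB.sub continuous_const)
      (fun x => by rw [bodyWidth_neg]) hp (e.norm_eq_one 0) (e.norm_eq_one 1) (hpe 0) (hpe 1)
      (e.inner_eq_zero (i := 0) (j := 1) (by decide)) fun v w hv hw hvw => ?_)
    obtain ⟨ω, hω, hωv, hωw⟩ := exists_norm_eq_one_inner_eq_zero v w
    obtain ⟨b, rfl, rfl⟩ := exists_orthonormalBasis_orthogonal (hne hω) hv hw hvw hωv hωw
    have h := hc ω (mem_sphere_zero_iff_norm.mpr hω)
    have hdir : ∀ θ, ((angleDir b θ : (Submodule.span ℝ {ω})ᗮ) : E3) = cos θ • (b 0 : E3) + sin θ • (b 1 : E3) := fun θ => rfl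
    -- `ENNReal.ofReal` is injective only on nonnegative reals.
    have hint : 0 ≤ ∫ θ in (0 : ℝ)..2 * π, bodyWidth Ω (angleDir b θ : (Submodule.span ℝ {ω})ᗮ) :=
      intervalIntegral.integral_nonneg two_pi_pos.le fun θ _ =>
        bodyWidth_nonneg hcomp (interior_subset hzero) _
    rw [circumference_eq hconv hcomp hzero ω b, ← ENNReal.ofReal_coe_nnreal,
      ENNReal.ofReal_eq_ofReal_iff (by positivity) c.coe_nonneg] at h
    simp only [hdir] at h
    rw [intervalIntegral.integral_sub
      (Continuous.intervalIntegrable (by fun_prop) _ _) (by simp),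
      intervalIntegral.integral_const, smul_eq_mul]
    have : (2 * π - 0) * (c / π) = 2 * (c : ℝ) := by
      have := pi_pos.ne'
      field_simp
      ring
    linarith
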